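/- Let $\mathbb{R}$ be the scalar field. For a Banach space $X$ and a finite-dimensional subspace $Y\subset X$, let $\mathcal{P}(X,Y)$ be the set of continuous linear maps $P\colon X\to Y$ with $P|_Y=\mathrm{Id}_Y$, and let $\lambda_{\mathbb{R}}(Y,X)=\inf\{\|P\| : P\in\mathcal{P}(X,Y)\}$. For a finite-dimensional real normed space $Y$, let $\lambda_{\mathbb{R}}(Y)=\sup\lambda_{\mathbb{R}}(Y,X)$, where the supremum is over all real Banach spaces $X$ containing $Y$ isometrically as a subspace. For $m\ge 1$, let the maximal absolute projection constant be $\lambda_{\mathbb{R}}(m)=\sup\{\lambda_{\mathbb{R}}(Y) : \dim Y=m\}$, where the supremum is over all real normed spaces $Y$ of dimension $m$. Then $$\lambda_{\mathbb{R}}(2)=\frac43,\qquad \lambda_{\mathbb{R}}(3)=\frac{1+\sqrt5}{2},\qquad \lambda_{\mathbb{R}}(7)=\frac52,\qquad \lambda_{\mathbb{R}}(23)=\frac{14}{3}.$$ -/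

import Mathlib

universe u v

open scoped ENNReal

namespace ProjectionConstants

/-- The set `𝒫(X, Y)` of continuous linear projections from `X` onto the subspace `Y`, i.e. of
continuous linear maps `P : X → Y` that restrict to the identity on `Y`. -/
def projections {𝕜 : Type*} [RCLike 𝕜] {X : Type*} [NormedAddCommGroup X] [NormedSpace 𝕜 X]
    (Y : Submodule 𝕜 X) : Set (X →L[𝕜] Y) :=
  {P | ∀ y : Y, P (y : X) = y}

/-- The relative projection constant `λ(Y, X) = inf {‖P‖ : P ∈ 𝒫(X, Y)}` of a subspace `Y` of `X`,
an element of `[0, ∞]`. -/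
noncomputable def relative {𝕜 : Type*} [RCLike 𝕜] {X : Type*} [NormedAddCommGroup X]
    [NormedSpace 𝕜 X] (Y : Submodule 𝕜 X) : ℝ≥0∞ :=
  ⨅ P ∈ projections Y, ENNReal.ofReal ‖P‖

/-- The absolute projection constant `λ(Y) = sup {λ(Y, X) : Y ⊆ X}` of a normed space `Y`, where
the supremum is over all Banach spaces `X` that contain `Y` isometrically, that is, over all Banach
spaces `X` and all linear isometric embeddings `j` of `Y` into `X`. -/
noncomputable def absolute (𝕜 : Type*) [RCLike 𝕜] (Y : Type v) [NormedAddCommGroup Y]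
    [NormedSpace 𝕜 Y] : ℝ≥0∞ :=
  ⨆ (X : Type u) (_ : NormedAddCommGroup X) (_ : NormedSpace 𝕜 X) (_ : CompleteSpace X)
    (j : Y →ₗᵢ[𝕜] X), relative (LinearMap.range j.toLinearMap)

/-- The maximal absolute projection constant `λ_𝕜(m) = sup {λ(Y) : dim Y = m}`, where the supremum
is over all `m`-dimensional normed spaces `Y` over `𝕜`. -/
noncomputable def maximalAbsolute (𝕜 : Type*) [RCLike 𝕜] (m : ℕ) : ℝ≥0∞ :=
  ⨆ (Y : Type v) (_ : NormedAddCommGroup Y) (_ : NormedSpace 𝕜 Y) (_ : FiniteDimensional 𝕜 Y)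
    (_ : Module.finrank 𝕜 Y = m), absolute.{u, v} 𝕜 Y

end ProjectionConstants

open Finset

namespace ProjectionConstants

section Welch

variable {ι κ : Type*} [Fintype ι] [Fintype κ]

/-- The trace of the square of a weighted sum of rank-one matrices. -/
theorem sum_sq_sum_rankOne (p : ι → ℝ) (u : ι → κ → ℝ) :
    ∑ k, ∑ l, (∑ i, p i * u i k * u i l) ^ 2 =
      ∑ i, ∑ j, p i * p j * (u i ⬝ᵥ u j) ^ 2 := by
  calc _ = ∑ k, ∑ l, ∑ i, ∑ j, p i * u i k * u i l * (p j * u j k * u j l) := by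
        simp only [sq, sum_mul_sum]
    _ = ∑ k, ∑ i, ∑ l, ∑ j, p i * u i k * u i l * (p j * u j k * u j l) :=
        sum_congr rfl fun k _ => sum_comm
    _ = ∑ i, ∑ k, ∑ l, ∑ j, p i * u i k * u i l * (p j * u j k * u j l) := sum_comm
    _ = ∑ i, ∑ k, ∑ j, ∑ l, p i * u i k * u i l * (p j * u j k * u j l) :=
        sum_congr rfl fun i _ => sum_congr rfl fun k _ => sum_comm
    _ = ∑ i, ∑ j, ∑ k, ∑ l, p i * u i k * u i l * (p j * u j k * u j l) :=
        sum_congr rfl fun i _ => sum_comm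
    _ = _ := by
        simp only [sq, dotProduct, sum_mul_sum]
        simp only [mul_sum]
        refine sum_congr rfl fun i _ => sum_congr rfl fun j _ => sum_congr rfl fun k _ =>
          sum_congr rfl fun l _ => ?_
        ring

theorem sum_sub_mul_sq (T D : κ → κ → ℝ) (c : ℝ) :
    ∑ k, ∑ l, (T k l - c * D k l) ^ 2 =
      ∑ k, ∑ l, T k l ^ 2 - 2 * c * ∑ k, ∑ l, T k l * D k l + c ^ 2 * ∑ k, ∑ l, D k l ^ 2 := by
  simp only [mul_sum, ← sum_sub_distrib, ← sum_add_distrib]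
  refine sum_congr rfl fun k _ => sum_congr rfl fun l _ => ?_
  ring

/-- The second order Welch bound. -/
theorem three_mul_sq_sum_le [DecidableEq κ] [Nonempty κ] (p : ι → ℝ) (u : ι → κ → ℝ)
    (hu : ∀ i, p i ≠ 0 → u i ⬝ᵥ u i = 1) :
    3 * (∑ i, p i) ^ 2 ≤ (Fintype.card κ : ℝ) * (Fintype.card κ + 2) *
      ∑ i, ∑ j, p i * p j * (u i ⬝ᵥ u j) ^ 4 := by
  set m : ℝ := (Fintype.card κ : ℝ) with hm
  have hm0 : 0 < m := by positivity
  -- the fourth moment, as a matrix indexed by pairs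
  let U : ι → κ × κ → ℝ := fun i k => u i k.1 * u i k.2
  let δ : κ → κ → ℝ := fun k l => if k = l then 1 else 0
  let D : κ × κ → κ × κ → ℝ := fun k l =>
    δ k.1 k.2 * δ l.1 l.2 + δ k.1 l.1 * δ k.2 l.2 + δ k.1 l.2 * δ k.2 l.1
  have hUU : ∀ i j, U i ⬝ᵥ U j = (u i ⬝ᵥ u j) ^ 2 := by
    intro i j
    simp only [U, dotProduct, sq, sum_mul_sum, Fintype.sum_prod_type]
    refine sum_congr rfl fun k _ => sum_congr rfl fun l _ => ?_
    ring
  have h1 : ∑ k, ∑ l, (∑ i, p i * U i k * U i l) ^ 2 =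
      ∑ i, ∑ j, p i * p j * (u i ⬝ᵥ u j) ^ 4 := by
    rw [sum_sq_sum_rankOne]
    refine sum_congr rfl fun k _ => sum_congr rfl fun l _ => ?_
    rw [hUU]; ring
  have h2 : ∑ k, ∑ l, (∑ i, p i * U i k * U i l) * D k l = 3 * ∑ i, p i := by
    have hi : ∀ i, ∑ k, ∑ l, p i * U i k * U i l * D k l = 3 * p i := by
      intro i
      have : ∑ k, ∑ l, U i k * U i l * D k l = 3 * (u i ⬝ᵥ u i) ^ 2 := by
        simp only [U, D, δ, Fintype.sum_prod_type, mul_add, sum_add_distrib, dotProduct, sq,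
          sum_mul_sum]
        simp
        simp only [← sum_add_distrib, mul_sum]
        refine sum_congr rfl fun k _ => sum_congr rfl fun l _ => ?_
        ring
      by_cases h : p i = 0
      · simp [h]
      · rw [hu i h] at this
        simp only [mul_assoc, ← mul_sum] at this ⊢
        rw [this]; ring
    rw [mul_sum, ← sum_congr rfl fun i _ => hi i]
    simp only [sum_mul]
    calc _ = ∑ k, ∑ i, ∑ l, p i * U i k * U i l * D k l := sum_congr rfl fun k _ => sum_comm
      _ = _ := sum_comm
  have h3 : ∑ k, ∑ l, D k l ^ 2 = 3 * (m * (m + 2)) := by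
    simp only [D, δ, Fintype.sum_prod_type, sq, add_mul, mul_add, sum_add_distrib]
    simp [← hm]
    ring
  set W := ∑ i, ∑ j, p i * p j * (u i ⬝ᵥ u j) ^ 4
  set e := ∑ i, p i
  have h4 : ∀ c : ℝ, 0 ≤ W - 2 * c * (3 * e) + c ^ 2 * (3 * (m * (m + 2))) := by
    intro c
    rw [← h1, ← h2, ← h3, ← sum_sub_mul_sq]
    positivity
  have h5 := h4 (e / (m * (m + 2)))
  field_simp at h5
  nlinarith

end Welch

section Core

variable {ι κ : Type*} [Fintype ι] [Fintype κ]

theorem sq_dotProduct_le (x y : κ → ℝ) : (x ⬝ᵥ y) ^ 2 ≤ (x ⬝ᵥ x) * (y ⬝ᵥ y) := by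
  simpa [dotProduct, sq] using sum_mul_sq_le_sq_mul_sq univ x y

theorem zero_le_dotProduct_self (x : κ → ℝ) : 0 ≤ x ⬝ᵥ x :=
  sum_nonneg fun k _ => mul_self_nonneg (x k)

/-- The quartic majorant of the absolute value that touches it at `a` and at `1`. -/
theorem le_quartic {a s : ℝ} (ha : 0 < a) (hs : 0 ≤ s) (hs1 : s ≤ 1) :
    2 * a * (1 + a) ^ 2 * s ≤
      a ^ 2 * (1 + 2 * a) + (3 * a ^ 2 + 2 * a + 1) * s ^ 2 - s ^ 4 := by
  have : 0 ≤ (s - a) ^ 2 * (1 - s) * (s + 1 + 2 * a) := by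
    have := sub_nonneg.2 hs1
    positivity
  nlinarith

/-- If `∑ d i • x i ⊗ x i` is the identity, `∑ d i = 1` and `d i • x i = p i • u i` with `u i`
in the unit ball, then `∑ p i • u i ⊗ u i` has Hilbert-Schmidt norm at most one. -/
theorem sum_mul_sq_dotProduct_le_one [DecidableEq κ] {d p : ι → ℝ} {x u : ι → κ → ℝ}
    (hd : ∀ i, 0 ≤ d i) (hsum : ∑ i, d i = 1)
    (hx : ∀ k l, ∑ i, d i * x i k * x i l = if k = l then 1 else 0)
    (hu : ∀ i, u i ⬝ᵥ u i ≤ 1) (hpu : ∀ i k, p i * u i k = d i * x i k) :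
    ∑ i, ∑ j, p i * p j * (u i ⬝ᵥ u j) ^ 2 ≤ 1 := by
  set M : κ → κ → ℝ := fun k l => ∑ i, p i * u i k * u i l
  set q := ∑ i, ∑ j, p i * p j * (u i ⬝ᵥ u j) ^ 2
  have hq : ∑ k, ∑ l, M k l ^ 2 = q := sum_sq_sum_rankOne p u
  -- the vectors `M (x i)`
  let y : ι → κ → ℝ := fun i l => ∑ k, M k l * x i k
  have h1 : ∑ i, d i * (y i ⬝ᵥ u i) = q := by
    rw [← hq]
    simp only [y, dotProduct, sum_mul, mul_sum]
    calc _ = ∑ i, ∑ k, ∑ l, d i * (M k l * x i k * u i l) := sum_congr rfl fun i _ => sum_comm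
      _ = ∑ k, ∑ i, ∑ l, d i * (M k l * x i k * u i l) := sum_comm
      _ = ∑ k, ∑ l, ∑ i, d i * (M k l * x i k * u i l) := sum_congr rfl fun i _ => sum_comm
      _ = _ := by
        refine sum_congr rfl fun k _ => sum_congr rfl fun l _ => ?_
        rw [sq]
        conv_rhs => rw [show M k l * M k l = M k l * ∑ i, p i * u i k * u i l from rfl, mul_sum]
        refine sum_congr rfl fun i _ => ?_
        rw [hpu]; ring
  have h2 : ∑ i, d i * (y i ⬝ᵥ y i) = q := by
    rw [← hq]
    simp only [y, dotProduct, sum_mul_sum]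
    simp only [mul_sum]
    calc _ = ∑ l, ∑ i, ∑ k, ∑ k', d i * (M k l * x i k * (M k' l * x i k')) := sum_comm
      _ = ∑ l, ∑ k, ∑ i, ∑ k', d i * (M k l * x i k * (M k' l * x i k')) :=
        sum_congr rfl fun i _ => sum_comm
      _ = ∑ l, ∑ k, ∑ k', ∑ i, d i * (M k l * x i k * (M k' l * x i k')) :=
        sum_congr rfl fun i _ => sum_congr rfl fun i _ => sum_comm
      _ = ∑ l, ∑ k, ∑ k', M k l * M k' l * (if k = k' then 1 else 0) := by
        refine sum_congr rfl fun l _ => sum_congr rfl fun k _ => sum_congr rfl fun k' _ => ?_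
        rw [← hx, mul_sum]
        refine sum_congr rfl fun i _ => ?_
        ring
      _ = _ := by
        rw [sum_comm]
        simp [sq]
  have h3 : ∀ i, d i * (2 * (y i ⬝ᵥ u i)) ≤ d i * (y i ⬝ᵥ y i) + d i := by
    intro i
    have : 0 ≤ (y i - u i) ⬝ᵥ (y i - u i) := zero_le_dotProduct_self _
    simp only [sub_dotProduct, dotProduct_sub] at this
    rw [dotProduct_comm (u i) (y i)] at this
    nlinarith [hd i, hu i]
  have h4 := sum_le_sum fun i (_ : i ∈ univ) => h3 i
  rw [sum_add_distrib, h2, hsum] at h4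
  have : ∑ i, d i * (2 * (y i ⬝ᵥ u i)) = 2 * q := by
    rw [← h1, mul_sum]
    exact sum_congr rfl fun i _ => by ring
  linarith

theorem sum_abs_dotProduct_le_of_sum_eq_one [DecidableEq κ] {a : ℝ} (ha : 0 < a)
    (ham : a ^ 2 * (Fintype.card κ + 2) = 1) (hm : 2 ≤ Fintype.card κ)
    {d : ι → ℝ} {x : ι → κ → ℝ} (hd : ∀ i, 0 ≤ d i) (hsum : ∑ i, d i = 1)
    (hx : ∀ k l, ∑ i, d i * x i k * x i l = if k = l then 1 else 0) :
    ∑ i, ∑ j, d i * d j * |x i ⬝ᵥ x j| ≤ (1 + 2 * a) * (1 - a) / (a * (1 + a)) := by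
  have : Nonempty κ := Fintype.card_pos_iff.1 (by omega)
  set m : ℝ := (Fintype.card κ : ℝ) with hmdef
  have hm2 : (2 : ℝ) ≤ m := by rw [hmdef]; exact_mod_cast hm
  let n : ι → ℝ := fun i => √(x i ⬝ᵥ x i)
  have hn0 : ∀ i, 0 ≤ n i := fun i => Real.sqrt_nonneg _
  have hn2 : ∀ i, n i ^ 2 = x i ⬝ᵥ x i := fun i => Real.sq_sqrt (zero_le_dotProduct_self _)
  let u : ι → κ → ℝ := fun i => (n i)⁻¹ • x i
  let p : ι → ℝ := fun i => d i * n i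
  have hp0 : ∀ i, 0 ≤ p i := fun i => mul_nonneg (hd i) (hn0 i)
  have huu : ∀ i, n i ≠ 0 → u i ⬝ᵥ u i = 1 := by
    intro i hi
    simp only [u, smul_dotProduct, dotProduct_smul, smul_eq_mul, ← hn2]
    field_simp
  have hu1 : ∀ i, u i ⬝ᵥ u i ≤ 1 := by
    intro i
    by_cases hi : n i = 0
    · simp [u, hi]
    · exact (huu i hi).le
  have hxu : ∀ i, x i = n i • u i := by
    intro i
    by_cases hi : n i = 0
    · have := hn2 i
      rw [hi] at this
      simp [hi, dotProduct_self_eq_zero.1 (this.symm.trans (by simp))]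
    · simp [u, smul_smul, hi]
  have hq := sum_mul_sq_dotProduct_le_one (p := p) hd hsum hx hu1 fun i k => by
    conv_rhs => rw [hxu i]
    simp [p, mul_assoc]
  have hw := three_mul_sq_sum_le p u fun i hi => huu i (right_ne_zero_of_mul hi)
  set q := ∑ i, ∑ j, p i * p j * (u i ⬝ᵥ u j) ^ 2
  set W := ∑ i, ∑ j, p i * p j * (u i ⬝ᵥ u j) ^ 4
  set e := ∑ i, p i
  have he : e ^ 2 ≤ m := by
    have h1 : ∑ i, d i * n i ^ 2 = m := by
      simp only [hn2, dotProduct, mul_sum]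
      rw [sum_comm]
      simp only [← mul_assoc, hx]
      simp [hmdef]
    have h2 := sum_mul_sq_le_sq_mul_sq univ (fun i => √(d i)) (fun i => √(d i) * n i)
    have h3 : ∀ i, √(d i) * (√(d i) * n i) = p i := fun i => by
      rw [← mul_assoc, Real.mul_self_sqrt (hd i)]
    simp only [h3, mul_pow, Real.sq_sqrt (hd _), hsum, h1, one_mul] at h2
    exact h2
  have hpt : ∀ i j, 2 * a * (1 + a) ^ 2 * (d i * d j * |x i ⬝ᵥ x j|) ≤
      a ^ 2 * (1 + 2 * a) * (p i * p j) + (3 * a ^ 2 + 2 * a + 1) * (p i * p j * (u i ⬝ᵥ u j) ^ 2)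
        - p i * p j * (u i ⬝ᵥ u j) ^ 4 := by
    intro i j
    have h1 : d i * d j * |x i ⬝ᵥ x j| = p i * p j * |u i ⬝ᵥ u j| := by
      conv_lhs => rw [hxu i, hxu j]
      simp only [smul_dotProduct, dotProduct_smul, smul_eq_mul, abs_mul, abs_of_nonneg (hn0 _), p]
      ring
    have h2 : |u i ⬝ᵥ u j| ≤ 1 := by
      rw [← sq_le_one_iff_abs_le_one]
      exact (sq_dotProduct_le _ _).trans (mul_le_one₀ (hu1 i) (zero_le_dotProduct_self _) (hu1 j))
    have h3 := mul_le_mul_of_nonneg_left (le_quartic ha (abs_nonneg _) h2)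
      (mul_nonneg (hp0 i) (hp0 j))
    rw [sq_abs, show |u i ⬝ᵥ u j| ^ 4 = (u i ⬝ᵥ u j) ^ 4 from (by decide : Even 4).pow_abs _] at h3
    rw [h1]
    linarith
  have hS := sum_le_sum fun i (_ : i ∈ univ) => sum_le_sum fun j (_ : j ∈ univ) => hpt i j
  simp only [sum_sub_distrib, sum_add_distrib, ← mul_sum] at hS
  set S := ∑ i, ∑ j, d i * d j * |x i ⬝ᵥ x j|
  have hee : ∑ i, p i * ∑ j, p j = e ^ 2 := by rw [← sum_mul, sq]
  rw [hee] at hS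
  change _ ≤ a ^ 2 * (1 + 2 * a) * e ^ 2 + (3 * a ^ 2 + 2 * a + 1) * q - W at hS
  have hW : 3 * a ^ 2 / m * e ^ 2 ≤ W := by
    rw [div_mul_eq_mul_div, div_le_iff₀ (by linarith)]
    nlinarith [sq_nonneg a]
  have hc : 0 ≤ a ^ 2 * (1 + 2 * a) - 3 * a ^ 2 / m := by
    have : 3 / m ≤ 1 + 2 * a := by
      rw [div_le_iff₀ (by linarith)]
      by_cases h3 : 3 ≤ m <;> nlinarith
    have := mul_le_mul_of_nonneg_left this (sq_nonneg a)
    rw [show 3 * a ^ 2 / m = a ^ 2 * (3 / m) by ring]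
    linarith
  have h5 : 2 * a * (1 + a) ^ 2 * S ≤
      (a ^ 2 * (1 + 2 * a) - 3 * a ^ 2 / m) * m + (3 * a ^ 2 + 2 * a + 1) * 1 := by
    nlinarith [mul_le_mul_of_nonneg_left he hc,
      mul_le_mul_of_nonneg_left hq (by positivity : 0 ≤ 3 * a ^ 2 + 2 * a + 1)]
  have h6 : (a ^ 2 * (1 + 2 * a) - 3 * a ^ 2 / m) * m =
      (1 + 2 * a) * (1 - 2 * a ^ 2) - 3 * a ^ 2 := by
    have : a ^ 2 * m = 1 - 2 * a ^ 2 := by linarith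
    rw [sub_mul, div_mul_cancel₀ _ (by linarith), ← this]; ring
  rw [h6] at h5
  rw [le_div_iff₀ (by positivity)]
  have h7 : 0 < 2 * (1 + a) := by positivity
  refine le_of_mul_le_mul_left ?_ h7
  linarith

theorem sum_abs_dotProduct_le [DecidableEq κ] {a : ℝ} (ha : 0 < a)
    (ham : a ^ 2 * (Fintype.card κ + 2) = 1) (hm : 2 ≤ Fintype.card κ)
    {d : ι → ℝ} {x : ι → κ → ℝ} (hd : ∀ i, 0 ≤ d i)
    (hx : ∀ k l, ∑ i, d i * x i k * x i l = if k = l then 1 else 0) :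
    ∑ i, ∑ j, d i * d j * |x i ⬝ᵥ x j| ≤
      (1 + 2 * a) * (1 - a) / (a * (1 + a)) * ∑ i, d i := by
  set s := ∑ i, d i with hs
  have hs0 : 0 ≤ s := sum_nonneg fun i _ => hd i
  rcases hs0.eq_or_lt with h0 | h0
  · have : ∀ i, d i = 0 := fun i =>
      (sum_eq_zero_iff_of_nonneg fun i _ => hd i).1 h0.symm i (mem_univ i)
    simp [this, ← h0]
  have h := sum_abs_dotProduct_le_of_sum_eq_one (d := fun i => d i / s) (x := fun i => √s • x i)
    ha ham hm (fun i => by have := hd i; positivity) (by rw [← sum_div, ← hs, div_self h0.ne'])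
    (fun k l => by
      rw [← hx k l]
      refine sum_congr rfl fun i _ => ?_
      simp only [Pi.smul_apply, smul_eq_mul]
      field_simp
      rw [Real.sq_sqrt hs0])
  rw [← div_le_iff₀ h0]
  refine le_of_eq_of_le ?_ h
  rw [sum_div]
  refine sum_congr rfl fun i _ => ?_
  rw [sum_div]
  refine sum_congr rfl fun j _ => ?_
  simp only [smul_dotProduct, dotProduct_smul, smul_eq_mul, abs_mul, abs_of_nonneg
    (Real.sqrt_nonneg s)]
  rw [← mul_assoc √s √s, Real.mul_self_sqrt hs0]
  field_simp

end Core

section Upper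

/-- A finite separating family of functionals on a finite-dimensional space, with positive weights,
admits an orthonormal basis. -/
theorem exists_orthonormal_family {Y ι : Type*} [AddCommGroup Y] [Module ℝ Y]
    [FiniteDimensional ℝ Y] [Fintype ι] (f : ι → Y →ₗ[ℝ] ℝ)
    (hf : ∀ y, (∀ i, f i y = 0) → y = 0) {d : ι → ℝ}
    (hd : ∀ i, 0 < d i) :
    ∃ b : Fin (Module.finrank ℝ Y) → Y,
      (∀ k l, ∑ i, d i * f i (b k) * f i (b l) = if k = l then 1 else 0) ∧
      ∀ y, ∑ k, (∑ i, d i * f i y * f i (b k)) • b k = y := by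
  let J : Y →ₗ[ℝ] EuclideanSpace ℝ ι :=
    (WithLp.linearEquiv 2 ℝ (ι → ℝ)).symm.toLinearMap ∘ₗ LinearMap.pi fun i => √(d i) • f i
  have hJ : ∀ y i, J y i = √(d i) * f i y := fun y i => rfl
  have hinj : Function.Injective J := by
    rw [injective_iff_map_eq_zero]
    intro y hy
    refine hf y fun i => ?_
    have h := hJ y i
    rw [hy] at h
    have := (Real.sqrt_pos.2 (hd i)).ne'
    simpa [this] using h
  have hin : ∀ y z, inner ℝ (J y) (J z) = ∑ i, d i * f i y * f i z := by
    intro y z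
    rw [PiLp.inner_apply]
    refine sum_congr rfl fun i _ => ?_
    rw [hJ, hJ]
    have := Real.mul_self_sqrt (hd i).le
    simp only [RCLike.inner_apply, conj_trivial]
    calc _ = (√(d i) * √(d i)) * f i y * f i z := by ring
      _ = _ := by rw [this]
  let e := LinearEquiv.ofInjective J hinj
  have he : ∀ y, ((e y : LinearMap.range J) : EuclideanSpace ℝ ι) = J y := fun y => rfl
  have hfin : Module.finrank ℝ (LinearMap.range J) = Module.finrank ℝ Y := e.finrank_eq.symm
  let o := (stdOrthonormalBasis ℝ (LinearMap.range J)).reindex (finCongr hfin)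
  have ho : ∀ k, J (e.symm (o k)) = o k := fun k => by rw [← he, e.apply_symm_apply]
  refine ⟨fun k => e.symm (o k), fun k l => ?_, fun y => ?_⟩
  · rw [← hin, ho, ho, ← Submodule.coe_inner]
    exact orthonormal_iff_ite.1 o.orthonormal k l
  · apply e.injective
    rw [map_sum]
    conv_rhs => rw [← o.sum_repr' (e y)]
    refine sum_congr rfl fun k _ => ?_
    rw [map_smul, e.apply_symm_apply, ← hin, ho, Submodule.coe_inner, he, real_inner_comm]

/-- Minimax: among the systems `g` dual to a family `f` of functionals there is one with small
row sums, as soon as every weighted average of the row sums can be made small. -/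
theorem exists_dual_system {Y ι : Type*} [AddCommGroup Y] [Module ℝ Y] [FiniteDimensional ℝ Y]
    [Fintype ι] {a c : ℝ} (ha : 0 < a) (ham : a ^ 2 * (Module.finrank ℝ Y + 2) = 1)
    (hm : 2 ≤ Module.finrank ℝ Y) (hc : (1 + 2 * a) * (1 - a) / (a * (1 + a)) < c)
    (f : ι → Y →ₗ[ℝ] ℝ) (hf : ∀ y, (∀ i, f i y = 0) → y = 0) :
    ∃ g : ι → Y, (∀ y, ∑ j, f j y • g j = y) ∧ ∀ i, ∑ j, |f i (g j)| < c := by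
  classical
  set Λ := (1 + 2 * a) * (1 - a) / (a * (1 + a)) with hΛ
  have hΛ0 : 0 ≤ Λ := by
    have : a ≤ 1 := by
      have : (0 : ℝ) ≤ Module.finrank ℝ Y := by positivity
      nlinarith [sq_nonneg a]
    have := sub_nonneg.2 this
    positivity
  have : Nonempty ι := by
    by_contra h
    rw [not_nonempty_iff] at h
    have : Subsingleton Y := ⟨fun y z => by
      rw [hf y fun i => h.elim i, hf z fun i => h.elim i]⟩
    have := Module.finrank_zero_of_subsingleton (R := ℝ) (M := Y)
    omega
  by_contra! hcon
  let s : Set (ι → ι → ℝ) := {M | ∀ i, ∑ j, |M i j| < c}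
  let t : Set (ι → ι → ℝ) :=
    {M | ∃ g : ι → Y, (∀ y, ∑ j, f j y • g j = y) ∧ M = fun i j => f i (g j)}
  have hs : Convex ℝ s := by
    have : s = ⋂ i, {M : ι → ι → ℝ | ∑ j, |M i j| < c} := by ext; simp [s]
    rw [this]
    refine convex_iInter fun i => ?_
    have h : ConvexOn ℝ Set.univ fun M : ι → ι → ℝ => ∑ j, |M i j| := by
      refine ⟨convex_univ, fun M _ N _ p q hp hq _ => ?_⟩
      simp only [Pi.add_apply, Pi.smul_apply, smul_eq_mul, mul_sum, ← sum_add_distrib]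
      refine sum_le_sum fun j _ => (abs_add_le _ _).trans_eq ?_
      rw [abs_mul, abs_mul, abs_of_nonneg hp, abs_of_nonneg hq]
    simpa using h.convex_lt c
  have hso : IsOpen s := by
    have : s = ⋂ i, {M : ι → ι → ℝ | ∑ j, |M i j| < c} := by ext; simp [s]
    rw [this]
    exact isOpen_iInter_of_finite fun i => isOpen_lt (by fun_prop) continuous_const
  have ht : Convex ℝ t := by
    rintro _ ⟨g, hg, rfl⟩ _ ⟨g', hg', rfl⟩ p q hp hq hpq
    refine ⟨fun j => p • g j + q • g' j, fun y => ?_, ?_⟩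
    · simp only [smul_add, smul_comm _ p, smul_comm _ q, sum_add_distrib, ← smul_sum, hg, hg',
        ← add_smul, hpq, one_smul]
    · ext i j
      simp
  have hst : Disjoint s t := by
    rw [Set.disjoint_left]
    rintro _ hM ⟨g, hg, rfl⟩
    obtain ⟨i, hi⟩ := hcon g hg
    exact (hM i).not_ge hi
  obtain ⟨φ, u, hφs, hφt⟩ := geometric_hahn_banach_open hs hso ht hst
  let Z : ι → ι → ℝ := fun i j => φ (Pi.single i (Pi.single j 1))
  have hφ : ∀ M : ι → ι → ℝ, φ M = ∑ i, ∑ j, Z i j * M i j := by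
    intro M
    have : M = ∑ i, ∑ j, M i j • (Pi.single i (Pi.single j 1) : ι → ι → ℝ) := by
      ext i j
      simp [Finset.sum_apply, Pi.single_apply, ite_apply]
    conv_lhs => rw [this]
    simp [map_sum, Z, mul_comm]
  choose J hJ using fun i => Finite.exists_max fun j => |Z i j|
  set S := ∑ i, |Z i (J i)|
  have hS0 : 0 ≤ S := by positivity
  obtain ⟨c', hc1, hc2⟩ := exists_between hc
  have hlow : c' * S < u := by
    have hmem : (fun i j => if j = J i then c' * SignType.sign (Z i j) else 0 : ι → ι → ℝ) ∈ s := by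
      intro i
      have : ∑ j, |if j = J i then c' * ((SignType.sign (Z i j) : SignType) : ℝ) else 0| =
          |c' * ((SignType.sign (Z i (J i)) : SignType) : ℝ)| := by
        rw [sum_eq_single (J i)] <;> simp +contextual
      rw [this, abs_mul, abs_of_nonneg (hΛ0.trans hc1.le)]
      have : |((SignType.sign (Z i (J i)) : SignType) : ℝ)| ≤ 1 := by
        rcases SignType.sign (Z i (J i)) <;> simp
      nlinarith
    have h := hφs _ hmem
    rw [hφ] at h
    refine lt_of_eq_of_lt ?_ h
    rw [mul_sum]
    refine sum_congr rfl fun i _ => ?_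
    simp only [mul_ite, mul_zero, sum_ite_eq', mem_univ, if_true]
    rw [mul_left_comm, self_mul_sign]
  have hup : ∀ ε > 0, u ≤ Λ * S + ε := by
    intro ε hε
    set n : ℝ := (Fintype.card ι : ℝ) with hn
    have hn0 : 0 ≤ n := by positivity
    set η := ε / (Λ * n + 1) with hη
    have hη0 : 0 < η := by positivity
    have hηε : Λ * (n * η) ≤ ε := by
      rw [hη]
      have : 0 < Λ * n + 1 := by positivity
      rw [← mul_assoc, mul_div_assoc', div_le_iff₀ this]
      nlinarith
    let d : ι → ℝ := fun i => |Z i (J i)| + η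
    have hd : ∀ i, 0 < d i := fun i => by positivity
    obtain ⟨b, hb, hby⟩ := exists_orthonormal_family f hf hd
    have hcore := sum_abs_dotProduct_le (x := fun i k => f i (b k)) ha (by simpa using ham)
      (by simpa using hm) (fun i => (hd i).le) hb
    have hmem : (fun i j => f i (∑ k, (d j * f j (b k)) • b k)) ∈ t := by
      refine ⟨_, fun y => ?_, rfl⟩
      conv_rhs => rw [← hby y]
      simp only [smul_sum, sum_smul, smul_smul]
      rw [sum_comm]
      refine sum_congr rfl fun k _ => sum_congr rfl fun j _ => ?_
      congr 1; ring
    have h := hφt _ hmem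
    rw [hφ] at h
    have hds : ∑ i, d i = S + n * η := by simp [d, sum_add_distrib, S, hn]
    calc u ≤ _ := h
      _ ≤ ∑ i, ∑ j, d i * d j * |(fun k => f i (b k)) ⬝ᵥ (fun k => f j (b k))| := by
        refine sum_le_sum fun i _ => sum_le_sum fun j _ => ?_
        have h1 : f i (∑ k, (d j * f j (b k)) • b k) =
            d j * ((fun k => f i (b k)) ⬝ᵥ (fun k => f j (b k))) := by
          simp only [map_sum, map_smul, smul_eq_mul, dotProduct, mul_sum]
          exact sum_congr rfl fun k _ => by ring
        rw [h1]
        refine (le_abs_self _).trans ?_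
        rw [abs_mul, abs_mul, abs_of_pos (hd j), ← mul_assoc]
        have : |Z i j| ≤ d i := (hJ i j).trans (by simp [d, hη0.le])
        have := (hd j).le
        gcongr
      _ ≤ Λ * (S + n * η) := by rw [← hds]; exact hcore
      _ ≤ _ := by rw [mul_add]; gcongr
  have := le_of_forall_pos_le_add hup
  nlinarith

theorem exists_finite_norming {Y : Type*} [NormedAddCommGroup Y] [NormedSpace ℝ Y]
    [FiniteDimensional ℝ Y] {θ : ℝ} (hθ : θ < 1) :
    ∃ t : Finset (StrongDual ℝ Y), (∀ f ∈ t, ‖f‖ ≤ 1) ∧ ∀ y, y ≠ 0 → ∃ f ∈ t, θ * ‖y‖ < |f y| := by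
  classical
  have := FiniteDimensional.proper ℝ Y
  obtain ⟨t, ht⟩ := (isCompact_sphere (0 : Y) 1).elim_finite_subcover
    (fun f : {f : StrongDual ℝ Y // ‖f‖ ≤ 1} => {y : Y | θ < |f.1 y|})
    (fun f => isOpen_lt continuous_const (by fun_prop)) (by
      intro y hy
      obtain ⟨f, hf, hfy⟩ := exists_dual_vector'' ℝ y
      rw [mem_sphere_zero_iff_norm] at hy
      refine Set.mem_iUnion.2 ⟨⟨f, hf⟩, ?_⟩
      simp [hfy, hy, hθ])
  refine ⟨t.image Subtype.val, ?_, fun y hy => ?_⟩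
  · simp +contextual
  · have hy0 : 0 < ‖y‖ := norm_pos_iff.2 hy
    have h := ht (show ‖y‖⁻¹ • y ∈ Metric.sphere (0 : Y) 1 by
      rw [mem_sphere_zero_iff_norm, norm_smul, norm_inv, norm_norm, inv_mul_cancel₀ hy0.ne'])
    simp only [Set.mem_iUnion] at h
    obtain ⟨f, hft, hf⟩ := h
    refine ⟨f.1, mem_image_of_mem _ hft, ?_⟩
    simp only [Set.mem_ofPred_eq, map_smul, smul_eq_mul, abs_mul, abs_inv, abs_norm] at hf
    rwa [inv_mul_eq_div, lt_div_iff₀ hy0] at hf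

theorem relative_le {X : Type*} [NormedAddCommGroup X] [NormedSpace ℝ X] (Y : Submodule ℝ X)
    [FiniteDimensional ℝ Y] {a : ℝ} (ha : 0 < a) (ham : a ^ 2 * (Module.finrank ℝ Y + 2) = 1)
    (hm : 2 ≤ Module.finrank ℝ Y) :
    relative Y ≤ ENNReal.ofReal ((1 + 2 * a) * (1 - a) / (a * (1 + a))) := by
  set Λ := (1 + 2 * a) * (1 - a) / (a * (1 + a)) with hΛ
  by_contra! hlt
  obtain ⟨r, -, hr1, hr2⟩ := ENNReal.lt_iff_exists_real_btwn.1 hlt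
  have hΛr : Λ < r := ((ENNReal.ofReal_lt_ofReal_iff').1 hr1).1
  have hr : 0 < r := ((ENNReal.ofReal_lt_ofReal_iff').1 hr1).2
  obtain ⟨c, hc1, hc2⟩ := exists_between (max_lt hΛr hr)
  have hc0 : 0 < c := (le_max_right _ _).trans_lt hc1
  have hθ : c / r < 1 := (div_lt_one hr).2 hc2
  obtain ⟨t, ht1, ht2⟩ := exists_finite_norming (Y := Y) hθ
  have hsep : ∀ y : Y, (∀ f : t, f.1.toLinearMap y = 0) → y = 0 := by
    intro y hy
    by_contra h
    obtain ⟨f, hf, hfy⟩ := ht2 y h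
    have := hy ⟨f, hf⟩
    simp only [ContinuousLinearMap.coe_coe] at this
    rw [this, abs_zero] at hfy
    exact hfy.not_ge (by positivity)
  obtain ⟨g, hg, hgc⟩ := exists_dual_system ha ham hm ((le_max_left _ _).trans_lt hc1)
    (fun f : t => f.1.toLinearMap) hsep
  choose F hF1 hF2 using fun f : t => exists_extension_norm_eq Y f.1
  let P : X →L[ℝ] Y := ∑ f, (F f).smulRight (g f)
  have hP : ∀ x, P x = ∑ f, F f x • g f := fun x => by simp [P]
  have hPmem : P ∈ projections Y := by
    intro y
    rw [hP]
    conv_rhs => rw [← hg y]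
    exact sum_congr rfl fun f _ => by rw [hF1]; rfl
  have hPn : ‖P‖ ≤ r := by
    refine P.opNorm_le_bound hr.le fun x => ?_
    by_cases h0 : P x = 0
    · rw [h0, norm_zero]; positivity
    obtain ⟨f, hf, hfx⟩ := ht2 (P x) h0
    have h1 : |f (P x)| ≤ c * ‖x‖ := by
      rw [hP, map_sum]
      refine (abs_sum_le_sum_abs _ _).trans ?_
      refine le_trans ?_ (mul_le_mul_of_nonneg_right (hgc ⟨f, hf⟩).le (norm_nonneg x))
      rw [sum_mul]
      refine sum_le_sum fun f' _ => ?_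
      rw [map_smul, smul_eq_mul, abs_mul, mul_comm]
      refine mul_le_mul_of_nonneg_left ?_ (abs_nonneg _)
      refine ((F f').le_opNorm x).trans ?_
      rw [hF2]
      exact mul_le_of_le_one_left (norm_nonneg x) (ht1 _ f'.2)
    have h2 := hfx.le.trans h1
    rw [div_mul_eq_mul_div, div_le_iff₀ hr] at h2
    nlinarith
  refine hr2.not_ge ?_
  exact (iInf₂_le P hPmem).trans (ENNReal.ofReal_le_ofReal hPn)

theorem maximalAbsolute_le {m : ℕ} (hm : 2 ≤ m) {a : ℝ} (ha : 0 < a) (ham : a ^ 2 * (m + 2) = 1) :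
    maximalAbsolute.{u, v} ℝ m ≤ ENNReal.ofReal ((1 + 2 * a) * (1 - a) / (a * (1 + a))) := by
  refine iSup_le fun Y => iSup_le fun _ => iSup_le fun _ => iSup_le fun _ => iSup_le fun hY => ?_
  refine iSup_le fun X => iSup_le fun _ => iSup_le fun _ => iSup_le fun _ => iSup_le fun j => ?_
  have : Module.finrank ℝ (LinearMap.range j.toLinearMap) = m := by
    rw [← hY]
    exact LinearMap.finrank_range_of_inj j.injective
  exact relative_le _ ha (by rwa [this]) (by rwa [this])

end Upper

section Lower

variable {κ : Type*} [Fintype κ] {m : ℕ} {a r : ℝ} {w : κ → Fin m → ℝ}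

/-- A maximal system of equiangular lines is a tight frame. -/
theorem sum_mul_eq_of_equiangular (ham : a ^ 2 * (m + 2) = 1)
    (hcard : (2 * Fintype.card κ : ℝ) = m * (m + 1)) (hself : ∀ i, w i ⬝ᵥ w i = r)
    (hne : ∀ i j, i ≠ j → |w i ⬝ᵥ w j| = a * r) (k l : Fin m) :
    ∑ i, w i k * w i l = if k = l then r * (m + 1) / 2 else 0 := by
  classical
  set c := r * (m + 1) / 2 with hc
  have hsq : ∀ i j, (w i ⬝ᵥ w j) ^ 2 =
      a ^ 2 * r ^ 2 + if i = j then (1 - a ^ 2) * r ^ 2 else 0 := by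
    intro i j
    split_ifs with h
    · rw [h, hself]; ring
    · rw [← sq_abs, hne i j h]; ring
  have h1 := sum_sq_sum_rankOne (fun _ => 1) w
  simp only [one_mul, hsq, sum_add_distrib] at h1
  simp only [sum_const, card_univ, nsmul_eq_mul, sum_ite_eq, mem_univ, if_true] at h1
  have h2 : ∑ k, ∑ l, (∑ i, w i k * w i l) * (if k = l then 1 else 0) = Fintype.card κ * r := by
    simp only [mul_ite, mul_one, mul_zero, sum_ite_eq, mem_univ, if_true]
    rw [sum_comm]
    simp only [← dotProduct.eq_1, hself]
    simp
  have h3 : ∑ k : Fin m, ∑ l : Fin m, (if k = l then (1 : ℝ) else 0) ^ 2 = m := by simp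
  have h4 := sum_sub_mul_sq (fun k l => ∑ i, w i k * w i l) (fun k l => if k = l then 1 else 0) c
  rw [h1, h2, h3] at h4
  set N : ℝ := (Fintype.card κ : ℝ)
  have hN : N = m * (m + 1) / 2 := by linarith
  have h5 : N * (N * (a ^ 2 * r ^ 2)) + N * ((1 - a ^ 2) * r ^ 2) - 2 * c * (N * r) + c ^ 2 * m
      = 0 := by
    rw [hN, hc]
    have : a ^ 2 * (m * (m + 1) / 2 - 1) = (m - 1) / 2 := by
      linear_combination (m - 1 : ℝ) / 2 * ham
    linear_combination (m * (m + 1) / 2 * r ^ 2 : ℝ) * this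
  rw [h5] at h4
  have h6 := (sum_eq_zero_iff_of_nonneg fun k _ => by positivity).1 h4 k (mem_univ k)
  have h7 := (sum_eq_zero_iff_of_nonneg fun l _ => by positivity).1 h6 l (mem_univ l)
  rw [sq_eq_zero_iff, sub_eq_zero] at h7
  simpa using h7

theorem eq_zero_of_dotProduct_eq_zero {c : ℝ} (hc : c ≠ 0)
    (hw : ∀ k l, ∑ i, w i k * w i l = if k = l then c else 0) {y : Fin m → ℝ}
    (hy : ∀ i, w i ⬝ᵥ y = 0) : y = 0 := by
  ext k
  have h : ∑ i, w i k * (w i ⬝ᵥ y) = c * y k := by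
    simp only [dotProduct, mul_sum, ← mul_assoc]
    rw [sum_comm]
    simp [← sum_mul, hw]
  simp only [hy, mul_zero, sum_const_zero] at h
  simpa [hc] using h.symm

/-- Trace duality with the sign matrix of a maximal system of equiangular lines. -/
theorem le_relative_of_equiangular (hm : 0 < m) (ha : 0 < a) (hr : 0 < r)
    (ham : a ^ 2 * (m + 2) = 1) (hcard : (2 * Fintype.card κ : ℝ) = m * (m + 1))
    (hself : ∀ i, w i ⬝ᵥ w i = r) (hne : ∀ i j, i ≠ j → |w i ⬝ᵥ w j| = a * r)
    (E : Submodule ℝ (κ → ℝ)) (hE : ∀ x, x ∈ E ↔ ∃ y, x = fun i => w i ⬝ᵥ y) :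
    ENNReal.ofReal ((1 + 2 * a) * (1 - a) / (a * (1 + a))) ≤ relative E := by
  classical
  refine le_iInf₂ fun P hP => ENNReal.ofReal_le_ofReal ?_
  have hw := sum_mul_eq_of_equiangular ham hcard hself hne
  set c := r * (m + 1) / 2 with hc
  have hc0 : c ≠ 0 := by positivity
  choose z hz using fun l : κ => (hE _).1 (P (Pi.single l 1)).2
  have hdual : ∀ y : Fin m → ℝ, ∑ l, (w l ⬝ᵥ y) • z l = y := by
    intro y
    have hy : (fun i => w i ⬝ᵥ y) ∈ E := (hE _).2 ⟨y, rfl⟩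
    have h1 : (P (fun i => w i ⬝ᵥ y) : κ → ℝ) = fun i => w i ⬝ᵥ y :=
      congrArg Subtype.val (hP ⟨_, hy⟩)
    rw [show (fun i => w i ⬝ᵥ y) = ∑ l, (w l ⬝ᵥ y) • (Pi.single l 1 : κ → ℝ) by
      ext i; simp [Finset.sum_apply, Pi.single_apply]] at h1
    simp only [map_sum, map_smul, Submodule.coe_sum, Submodule.coe_smul, hz] at h1
    rw [← sub_eq_zero]
    refine eq_zero_of_dotProduct_eq_zero hc0 hw fun i => ?_
    have h2 := congrFun h1 i
    simp only [Finset.sum_apply, Pi.smul_apply, smul_eq_mul, Pi.single_apply] at h2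
    simp only [mul_ite, mul_one, mul_zero, sum_ite_eq, mem_univ, if_true] at h2
    rw [dotProduct_sub, dotProduct_sum]
    simp only [dotProduct_smul, smul_eq_mul]
    linarith
  have htr : ∑ l, w l ⬝ᵥ z l = m := by
    have h : ∀ k, ∑ l, w l k * z l k = 1 := by
      intro k
      have := congrFun (hdual (Pi.single k 1)) k
      simpa [Finset.sum_apply] using this
    simp only [dotProduct]
    rw [sum_comm]
    simp [h]
  let s : κ → κ → ℝ := fun i l => (w i ⬝ᵥ w l - if i = l then (1 - a) * r else 0) / (a * r)
  have hs : ∀ i l, |s i l| ≤ 1 := by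
    intro i l
    simp only [s, abs_div, abs_of_pos (mul_pos ha hr)]
    rw [div_le_one (by positivity)]
    split_ifs with h
    · rw [h, hself, show r - (1 - a) * r = a * r by ring, abs_of_pos (by positivity)]
    · rw [sub_zero, hne i l h]
  have hle : ∀ i, ∑ l, s i l * (w i ⬝ᵥ z l) ≤ ‖P‖ := by
    intro i
    have h1 : ((P (s i) : E) : κ → ℝ) i = ∑ l, s i l * (w i ⬝ᵥ z l) := by
      rw [show s i = ∑ l, s i l • (Pi.single l 1 : κ → ℝ) by
        ext j; simp [Finset.sum_apply, Pi.single_apply]]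
      simp only [map_sum, map_smul, Submodule.coe_sum, Submodule.coe_smul, hz]
      simp [Finset.sum_apply, Pi.single_apply]
    rw [← h1]
    calc _ ≤ ‖((P (s i) : E) : κ → ℝ) i‖ := le_abs_self _
      _ ≤ ‖P (s i)‖ := norm_le_pi_norm _ i
      _ ≤ ‖P‖ * ‖s i‖ := P.le_opNorm _
      _ ≤ ‖P‖ * 1 := by
        gcongr
        exact (pi_norm_le_iff_of_nonneg zero_le_one).2 (hs i)
      _ = _ := mul_one _
  have hsum := sum_le_sum fun i (_ : i ∈ univ) => hle i
  have hval : ∑ i, ∑ l, s i l * (w i ⬝ᵥ z l) = (c * m - (1 - a) * r * m) / (a * r) := by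
    have h1 : ∀ l, ∑ i, (w i ⬝ᵥ w l) * (w i ⬝ᵥ z l) = c * (w l ⬝ᵥ z l) := by
      intro l
      simp only [dotProduct, sum_mul_sum]
      calc _ = ∑ k, ∑ i, ∑ k', w i k * w l k * (w i k' * z l k') := sum_comm
        _ = ∑ k, ∑ k', ∑ i, w i k * w l k * (w i k' * z l k') :=
          sum_congr rfl fun k _ => sum_comm
        _ = ∑ k, ∑ k', (if k = k' then c else 0) * (w l k * z l k') := by
          refine sum_congr rfl fun k _ => sum_congr rfl fun k' _ => ?_
          rw [← hw, sum_mul]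
          exact sum_congr rfl fun i _ => by ring
        _ = _ := by simp [mul_sum]
    rw [sum_comm]
    simp only [s, div_mul_eq_mul_div, ← sum_div, sub_mul, sum_sub_distrib, h1, ite_mul, zero_mul,
      sum_ite_eq', mem_univ, if_true, ← mul_sum, htr]
  rw [hval] at hsum
  simp only [sum_const, card_univ, nsmul_eq_mul] at hsum
  have hm0 : (0 : ℝ) < m := by exact_mod_cast hm
  have hN : (Fintype.card κ : ℝ) = m * (m + 1) / 2 := by linarith
  rw [hN, div_le_iff₀ (by positivity), hc] at hsum
  rw [div_le_iff₀ (by positivity)]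
  have h1 : (m + 1) / 2 - (1 - a) ≤ (m + 1) / 2 * ‖P‖ * a := by
    refine le_of_mul_le_mul_left ?_ (mul_pos hr hm0)
    linarith
  have h2 : a ^ 2 * (m + 1) = (1 - a) * (1 + a) := by linarith
  have h3 := mul_le_mul_of_nonneg_left h1 (by positivity : 0 ≤ 2 * a ^ 2)
  have h4 : (1 - a) * ((1 + 2 * a) * (1 - a)) ≤ (1 - a) * (‖P‖ * (a * (1 + a))) := by
    linear_combination h3 + (‖P‖ * a - 1) * h2
  refine le_of_mul_le_mul_left h4 ?_
  nlinarith

/-- A maximal system of equiangular lines spans a space with extremal projection constant. -/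
theorem le_maximalAbsolute_of_equiangular {ι : Type} [Fintype ι] {w : ι → Fin m → ℝ}
    (hm : 0 < m) (ha : 0 < a) (hr : 0 < r)
    (ham : a ^ 2 * (m + 2) = 1) (hcard : 2 * Fintype.card ι = m * (m + 1))
    (hself : ∀ i, w i ⬝ᵥ w i = r) (hne : ∀ i j, i ≠ j → |w i ⬝ᵥ w j| = a * r) :
    ENNReal.ofReal ((1 + 2 * a) * (1 - a) / (a * (1 + a))) ≤ maximalAbsolute.{u, v} ℝ m := by
  have hcard' : (2 * Fintype.card ι : ℝ) = m * (m + 1) := by exact_mod_cast hcard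
  let T : (Fin m → ℝ) →ₗ[ℝ] (ULift.{v} ι → ℝ) := Matrix.mulVecLin fun i => w i.down
  have hT : ∀ y i, T y i = w i.down ⬝ᵥ y := fun y i => rfl
  have hinj : Function.Injective T := by
    rw [injective_iff_map_eq_zero]
    intro y hy
    refine eq_zero_of_dotProduct_eq_zero (c := r * (m + 1) / 2) (by positivity)
      (sum_mul_eq_of_equiangular ham hcard' hself hne) fun i => ?_
    rw [← hT y ⟨i⟩, hy]; rfl
  let j : LinearMap.range T →ₗᵢ[ℝ] (ULift.{u} ι → ℝ) :=
    { toLinearMap := LinearMap.funLeft ℝ ℝ (fun i => ULift.up i.down) ∘ₗ Submodule.subtype _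
      norm_map' := fun y => by
        refine le_antisymm ?_ ?_
        · refine (pi_norm_le_iff_of_nonneg (norm_nonneg _)).2 fun i => ?_
          exact norm_le_pi_norm y.1 _
        · refine (pi_norm_le_iff_of_nonneg (norm_nonneg _)).2 fun i => ?_
          exact norm_le_pi_norm (fun i : ULift.{u} ι => y.1 (ULift.up i.down)) (ULift.up i.down) }
  have hrel := le_relative_of_equiangular (κ := ULift.{u} ι) (w := fun i => w i.down) hm ha hr ham
    (by simpa using hcard') (fun i => hself _) (fun i j h => hne _ _ fun h' => h (ULift.ext _ _ h'))
    (LinearMap.range j.toLinearMap) fun x => by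
      constructor
      · rintro ⟨⟨_, y, rfl⟩, rfl⟩
        exact ⟨y, rfl⟩
      · rintro ⟨y, rfl⟩
        exact ⟨⟨T y, y, rfl⟩, rfl⟩
  refine hrel.trans ?_
  have hdim : Module.finrank ℝ (LinearMap.range T) = m := by
    rw [LinearMap.finrank_range_of_inj hinj]; simp
  have h1 : relative (LinearMap.range j.toLinearMap) ≤ absolute.{u, v} ℝ (LinearMap.range T) :=
    le_iSup_of_le (ULift.{u} ι → ℝ) <| le_iSup_of_le _ <| le_iSup_of_le _ <|
      le_iSup_of_le inferInstance <| le_iSup_of_le j le_rfl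
  refine h1.trans ?_
  exact le_iSup_of_le (LinearMap.range T) <| le_iSup_of_le _ <| le_iSup_of_le _ <|
      le_iSup_of_le inferInstance <| le_iSup_of_le hdim le_rfl

theorem maximalAbsolute_eq_of_equiangular {ι : Type} [Fintype ι] {w : ι → Fin m → ℝ}
    (hm : 2 ≤ m) (ha : 0 < a) (hr : 0 < r)
    (ham : a ^ 2 * (m + 2) = 1) (hcard : 2 * Fintype.card ι = m * (m + 1))
    (hself : ∀ i, w i ⬝ᵥ w i = r) (hne : ∀ i j, i ≠ j → |w i ⬝ᵥ w j| = a * r) :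
    maximalAbsolute.{u, v} ℝ m = ENNReal.ofReal ((1 + 2 * a) * (1 - a) / (a * (1 + a))) :=
  (maximalAbsolute_le hm ha ham).antisymm
    (le_maximalAbsolute_of_equiangular (by omega) ha hr ham hcard hself hne)

end Lower

section Examples

theorem maximalAbsolute_two : maximalAbsolute.{u, v} ℝ 2 = ENNReal.ofReal (4 / 3) := by
  have h3 : √3 * √3 = 3 := Real.mul_self_sqrt (by norm_num)
  let w : Fin 3 → Fin 2 → ℝ := ![![2, 0], ![-1, √3], ![-1, -√3]]
  rw [maximalAbsolute_eq_of_equiangular (a := 1 / 2) (r := 4) (w := w) le_rfl (by norm_num)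
    (by norm_num) (by norm_num) (by simp)]
  · norm_num
  · intro i
    fin_cases i <;> simp [w, dotProduct, Fin.sum_univ_succ, h3] <;> norm_num
  · intro i j hij
    fin_cases i <;> fin_cases j <;> first
      | exact absurd rfl hij
      | (simp [w, dotProduct, Fin.sum_univ_succ, h3]; norm_num [abs_of_nonneg, abs_of_neg])

theorem maximalAbsolute_three :
    maximalAbsolute.{u, v} ℝ 3 = ENNReal.ofReal ((1 + √5) / 2) := by
  have h5 : √5 * √5 = 5 := Real.mul_self_sqrt (by norm_num)
  have h0 : 0 < √5 := by positivity
  obtain ⟨t, ht⟩ : ∃ t, t = (1 + √5) / 2 := ⟨_, rfl⟩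
  have ht0 : 0 < t := by rw [ht]; positivity
  have htt : t * t = t + 1 := by rw [ht]; linarith
  -- the diagonals of the icosahedron
  let w : Fin 6 → Fin 3 → ℝ :=
    ![![0, 1, t], ![0, 1, -t], ![1, t, 0], ![1, -t, 0], ![t, 0, 1], ![-t, 0, 1]]
  rw [maximalAbsolute_eq_of_equiangular (a := 1 / √5) (r := t + 2) (w := w) (by norm_num)
    (by positivity) (by positivity) (by field_simp; rw [Real.sq_sqrt] <;> norm_num) (by simp)]
  · congr 1
    field_simp
    nlinarith
  · intro i
    fin_cases i <;> simp [w, dotProduct, Fin.sum_univ_succ, htt] <;> ring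
  · have har : 1 / √5 * (t + 2) = t := by
      rw [ht]; field_simp; linarith
    have h1 : |1 - t * t| = t := by rw [htt, abs_of_nonpos] <;> linarith
    have h2 : |1 + -(t * t)| = t := h1
    have h3 : |-(t * t) + 1| = t := by rw [add_comm]; exact h1
    rw [har]
    intro i j hij
    fin_cases i <;> fin_cases j <;> first
      | exact absurd rfl hij
      | simp [w, dotProduct, Fin.sum_univ_succ, h2, h3, abs_of_pos ht0]

/-- The vectors supported on the lines of the Fano plane with all entries `±1` there, up to sign. -/
def fanoVector (i : Fin 7 × Fin 2 × Fin 2) (p : Fin 7) : ℤ :=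
  if p = i.1 then 1 else if p = i.1 + 1 then (-1) ^ i.2.1.val
    else if p = i.1 + 3 then (-1) ^ i.2.2.val else 0

theorem maximalAbsolute_seven : maximalAbsolute.{u, v} ℝ 7 = ENNReal.ofReal (5 / 2) := by
  have h : ∀ i j, |fanoVector i ⬝ᵥ fanoVector j| = if i = j then 3 else 1 := by decide +kernel
  have hcast : ∀ i j, (fun p => (fanoVector i p : ℝ)) ⬝ᵥ (fun p => (fanoVector j p : ℝ)) =
      ((fanoVector i ⬝ᵥ fanoVector j : ℤ) : ℝ) := by
    intro i j
    simp [dotProduct]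
  rw [maximalAbsolute_eq_of_equiangular (a := 1 / 3) (r := 3) (w := fun i p => fanoVector i p)
    (by norm_num) (by norm_num) (by norm_num) (by norm_num) (by simp)]
  · norm_num
  · intro i
    have h1 := h i i
    rw [if_pos rfl, abs_of_nonneg (sum_nonneg fun k _ => mul_self_nonneg _)] at h1
    rw [hcast, h1]
    norm_num
  · intro i j hij
    have h1 := h i j
    rw [if_neg hij] at h1
    rw [hcast, ← Int.cast_abs, h1]
    norm_num

/-- A block of the Steiner system `S(4, 7, 23)`. -/
def baseBlock : Finset (ZMod 23) := {0, 1, 2, 3, 5, 14, 17}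

/-- The nonzero squares modulo `23`. -/
def squares : Finset (ZMod 23) := {1, 2, 3, 4, 6, 8, 9, 12, 13, 16, 18}

/-- The blocks of the Steiner system `S(4, 7, 23)`, as images of one block under the affine maps
whose linear part is a square. -/
def block (g : squares × ZMod 23) : Finset (ZMod 23) :=
  univ.filter fun p => (p - g.2) * g.1 ∈ baseBlock

theorem card_filter_baseBlock : ∀ q ∈ squares, ∀ b,
    if q = 1 ∧ b = 0 then #{p | p ∈ baseBlock ∧ (p - b) * q ∈ baseBlock} = 7
    else #{p | p ∈ baseBlock ∧ (p - b) * q ∈ baseBlock} = 1 ∨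
      #{p | p ∈ baseBlock ∧ (p - b) * q ∈ baseBlock} = 3 := by
  decide +kernel

theorem squares_pow_mul : ∀ q ∈ squares, ∀ q' ∈ squares,
    q ^ 10 * q' ∈ squares ∧ q ^ 10 * q = 1 ∧ (q ^ 10 * q' = 1 → q = q') := by
  decide +kernel

theorem card_block_inter (g h : squares × ZMod 23) :
    #(block g ∩ block h) = 7 ∧ g = h ∨
      (#(block g ∩ block h) = 1 ∨ #(block g ∩ block h) = 3) ∧ g ≠ h := by
  obtain ⟨⟨q, hq⟩, b⟩ := g
  obtain ⟨⟨q', hq'⟩, c⟩ := h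
  obtain ⟨h1, h2, h3⟩ := squares_pow_mul q hq q' hq'
  have hcard : #(block ⟨⟨q, hq⟩, b⟩ ∩ block ⟨⟨q', hq'⟩, c⟩) =
      #{p | p ∈ baseBlock ∧ (p - (c - b) * q) * (q ^ 10 * q') ∈ baseBlock} := by
    have key : ∀ p, (p - c) * q' = ((p - b) * q - (c - b) * q) * (q ^ 10 * q') := fun p => by
      linear_combination (-(p - c) * q') * h2
    refine card_nbij' (fun p => (p - b) * q) (fun x => x * q ^ 10 + b) ?_ ?_ ?_ ?_
    · intro p hp
      simp only [block, coe_inter, coe_filter, mem_univ, true_and, Set.mem_inter_iff,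
        Set.mem_ofPred_eq] at hp ⊢
      exact ⟨hp.1, by rw [← key]; exact hp.2⟩
    · intro x hx
      have hx' : (x * q ^ 10 + b - b) * q = x := by linear_combination x * h2
      simp only [block, coe_inter, coe_filter, mem_univ, true_and, Set.mem_inter_iff,
        Set.mem_ofPred_eq] at hx ⊢
      rw [key, hx']
      exact hx
    · intro p _
      linear_combination (p - b) * h2
    · intro x _
      linear_combination x * h2
  have hmain := card_filter_baseBlock _ h1 ((c - b) * q)
  rw [← hcard] at hmain
  by_cases hg : (⟨⟨q, hq⟩, b⟩ : squares × ZMod 23) = ⟨⟨q', hq'⟩, c⟩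
  · left
    simp only [Prod.mk.injEq, Subtype.mk.injEq] at hg
    obtain ⟨rfl, rfl⟩ := hg
    rw [if_pos ⟨h2, by ring⟩] at hmain
    exact ⟨hmain, rfl⟩
  · right
    refine ⟨?_, hg⟩
    rw [if_neg] at hmain
    · exact hmain
    · rintro ⟨h4, h5⟩
      obtain rfl := h3 h4
      refine hg ?_
      have : c = b := by linear_combination q ^ 10 * h5 - (c - b) * h2
      rw [this]

/-- Coordinates of the `276` equiangular lines in dimension `23`. -/
noncomputable def equiangularVector (i : ZMod 23 ⊕ squares × ZMod 23) (p : ZMod 23) : ℝ :=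
  match i with
  | .inl q => (if p = q then 2 else 0) + (-2 - 3 * √3) / 23
  | .inr g => (if p ∈ block g then 1 else 0) + (-7 + √3) / 23

theorem equiangular_inl_inl (q q' : ZMod 23) :
    ∑ p, equiangularVector (.inl q) p * equiangularVector (.inl q') p =
      if q = q' then 5 else 1 := by
  have h3 : √3 ^ 2 = 3 := Real.sq_sqrt (by norm_num)
  simp only [equiangularVector, add_mul, mul_add, sum_add_distrib, ← sum_mul, ite_mul, mul_ite,
    zero_mul, mul_zero, sum_ite_eq', mem_univ, if_true, sum_const, card_univ, ZMod.card,
    nsmul_eq_mul]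
  simp only [eq_comm (a := q')]
  split_ifs <;> push_cast <;> linear_combination (9 / 23 : ℝ) * h3

theorem equiangular_inl_inr (q : ZMod 23) (g : squares × ZMod 23) :
    ∑ p, equiangularVector (.inl q) p * equiangularVector (.inr g) p =
      if q ∈ block g then 1 else -1 := by
  have h3 : √3 ^ 2 = 3 := Real.sq_sqrt (by norm_num)
  have hg : #(block g) = 7 := by simpa using card_block_inter g g
  have hs : ∑ p, (if p ∈ block g then (1 : ℝ) else 0) = 7 := by simp [hg]
  simp only [equiangularVector, add_mul, mul_add, sum_add_distrib, ← sum_mul, ← mul_sum, ite_mul,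
    hs, zero_mul, sum_ite_eq', mem_univ, if_true, sum_const, card_univ, ZMod.card, nsmul_eq_mul]
  split_ifs <;> push_cast <;> linear_combination (-3 / 23 : ℝ) * h3

theorem equiangular_inr_inr (g h : squares × ZMod 23) :
    ∑ p, equiangularVector (.inr g) p * equiangularVector (.inr h) p =
      #(block g ∩ block h) - 2 := by
  have h3 : √3 ^ 2 = 3 := Real.sq_sqrt (by norm_num)
  have hg : ∀ g, ∑ p, (if p ∈ block g then (1 : ℝ) else 0) = 7 := fun g => by
    have : #(block g) = 7 := by simpa using card_block_inter g g
    simp [this]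
  have hgh : ∑ p, (if p ∈ block g then (1 : ℝ) else 0) * (if p ∈ block h then (1 : ℝ) else 0) =
      #(block g ∩ block h) := by
    simp [← ite_and, ← mem_inter, inter_comm]
  simp only [equiangularVector, add_mul, mul_add, sum_add_distrib, ← sum_mul, ← mul_sum, hg, hgh,
    sum_const, card_univ, ZMod.card, nsmul_eq_mul]
  push_cast
  linear_combination (1 / 23 : ℝ) * h3

theorem maximalAbsolute_twentyThree :
    maximalAbsolute.{u, v} ℝ 23 = ENNReal.ofReal (14 / 3) := by
  rw [maximalAbsolute_eq_of_equiangular (m := 23) (a := 1 / 5) (r := 5) (w := equiangularVector)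
    (by norm_num) (by norm_num) (by norm_num) (by norm_num) (by simp [ZMod.card, squares]; decide)]
  · norm_num
  · rintro (q | g)
    · exact (equiangular_inl_inl q q).trans (if_pos rfl)
    · refine (equiangular_inr_inr g g).trans ?_
      have : #(block g ∩ block g) = 7 := by simpa using card_block_inter g g
      rw [this]; norm_num
  · have hsym : ∀ g q, |∑ p, equiangularVector (.inl q) p * equiangularVector (.inr g) p| = 1 := by
      intro g q
      rw [equiangular_inl_inr]
      split_ifs <;> simp
    rw [show (1 / 5 * 5 : ℝ) = 1 by norm_num]
    rintro (q | g) (q' | g') hij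
    · refine (congrArg _ (equiangular_inl_inl q q')).trans ?_
      rw [if_neg fun h => hij (congrArg _ h), abs_one]
    · exact hsym g' q
    · exact (congrArg _ (dotProduct_comm (m := ZMod 23) _ _)).trans (hsym g q')
    · refine (congrArg _ (equiangular_inr_inr g g')).trans ?_
      rcases card_block_inter g g' with h | ⟨h | h, -⟩
      · exact absurd (congrArg _ h.2) hij
      · rw [h]; norm_num
      · rw [h]; norm_num

end Examples

end ProjectionConstants

theorem theorem6 :
    ProjectionConstants.maximalAbsolute.{u, v} ℝ 2 = ENNReal.ofReal (4 / 3) ∧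
    ProjectionConstants.maximalAbsolute.{u, v} ℝ 3 = ENNReal.ofReal ((1 + Real.sqrt 5) / 2) ∧
    ProjectionConstants.maximalAbsolute.{u, v} ℝ 7 = ENNReal.ofReal (5 / 2) ∧
    ProjectionConstants.maximalAbsolute.{u, v} ℝ 23 = ENNReal.ofReal (14 / 3) :=
  ⟨ProjectionConstants.maximalAbsolute_two, ProjectionConstants.maximalAbsolute_three,
    ProjectionConstants.maximalAbsolute_seven, ProjectionConstants.maximalAbsolute_twentyThree⟩
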